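/- Consider the barrier coverage problem: given a barrier $[0,L]$ with $L\ge 0$ and $n$ sensors with initial locations $x_1\le x_2\le\dots\le x_n$ in $\mathbb{R}$ and radii $r_1,\dots,r_n>0$, a solution is a vector $y\in\mathbb{R}^n$ with $[0,L]\subseteq\bigcup_i [y_i-r_i,y_i+r_i]$; its cost is $\mathrm{cost}(y)=\sum_i|y_i-x_i|$, and it is optimal if its cost is minimum among all solutions. Let $\rho=\max_i r_i/\min_i r_i$. A set $S\subseteq\{1,\dots,n\}$ is active for $y$ if the intervals $[y_i-r_i,y_i+r_i]$, $i\in S$, cover $[0,L]$, and it is a minimal active set if in addition no proper subset of $S$ is active. A solution $y$ is order-preserving if it has an active set $S$ such that $y_i<y_j$ for all $i<j$ in $S$. Let $y$ be a solution with a minimal active set $S$. An untangling $\hat y$ of $(y,S)$ is the result of a finite process of the following kind. Each step chooses two currently active sensors $i<j$ whose (closed) intervals intersect and which are in the wrong order, $y_j<y_i$, and changes their locations (and no others) to $y'_i<y'_j$ such that the union of their two intervals remains the same; afterwards the set of active sensors is replaced by a minimal active set contained in it (which changes nothing if it is still minimal). The process ends when any two active sensors $i<j$ whose intervals intersect satisfy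 $y_i<y_j$. For $\beta\ge 0$, a $\beta$-balanced cost sharing scheme for $\hat y$ is a function $\xi:S\to\mathbb{R}_{\ge 0}$ with $\mathrm{cost}(\hat y)\le\sum_{i\in S}\xi(i)$ and $\xi(i)\le\beta\,|x_i-y_i|$ for all $i\in S$. **Lemma.** For every optimal solution $y$ and every minimal active set $S$ of $y$, there is an untangling $\hat y$ of $(y,S)$ that has a $(3\rho+4)$-balanced cost sharing scheme. Moreover, $\hat y$ is an order-preserving solution and $\mathrm{cost}(\hat y)\le(3\rho+4)\,\mathrm{cost}(z)$ for every solution $z$. -/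

import Mathlib

open scoped NNReal

/-- An instance of the min-sum barrier coverage problem: the barrier is `[0, L]`, and sensor `i` has
initial location `x i` and radius `r i > 0`; the sensors are numbered from left to right. -/
structure BarrierInstance (n : ℕ) where
  L : ℝ
  x : Fin n → ℝ
  r : Fin n → ℝ
  L_nonneg : 0 ≤ L
  r_pos : ∀ i, 0 < r i
  x_mono : Monotone x

namespace BarrierInstance

variable {n : ℕ} (I : BarrierInstance n)

/-- The interval covered by sensor `i` when the sensors stand at the locations `y`. -/
def interval (y : Fin n → ℝ) (i : Fin n) : Set ℝ :=
  Set.Icc (y i - I.r i) (y i + I.r i)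

/-- `y` is a (feasible) solution: the sensors cover the barrier. -/
def IsSolution (y : Fin n → ℝ) : Prop :=
  Set.Icc 0 I.L ⊆ ⋃ i, I.interval y i

/-- The total movement of the sensors. -/
def cost (y : Fin n → ℝ) : ℝ :=
  ∑ i, |y i - I.x i|

def IsOptimal (y : Fin n → ℝ) : Prop :=
  I.IsSolution y ∧ ∀ z, I.IsSolution z → I.cost y ≤ I.cost z

/-- `y` is a solution whose cost is at most `β` times the cost of every solution. -/
def IsApproximate (β : ℝ) (y : Fin n → ℝ) : Prop :=
  I.IsSolution y ∧ ∀ z, I.IsSolution z → I.cost y ≤ β * I.cost z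

/-- The ratio between the largest and the smallest radius. -/
noncomputable def rho : ℝ :=
  (⨆ i, I.r i) / (⨅ i, I.r i)

/-- The intervals in `S` alone cover the barrier. -/
def IsActive (y : Fin n → ℝ) (S : Finset (Fin n)) : Prop :=
  Set.Icc 0 I.L ⊆ ⋃ i ∈ S, I.interval y i

def IsMinimalActive (y : Fin n → ℝ) (S : Finset (Fin n)) : Prop :=
  I.IsActive y S ∧ ∀ T, T ⊂ S → ¬ I.IsActive y T

/-- Some active set has its sensors in the order of their indices. -/
def IsOrderPreserving (y : Fin n → ℝ) : Prop :=
  ∃ S, I.IsActive y S ∧ ∀ i ∈ S, ∀ j ∈ S, i < j → y i < y j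

/-- The (closed) intervals of `i` and `j` intersect. -/
def Overlap (y : Fin n → ℝ) (i j : Fin n) : Prop :=
  (I.interval y i ∩ I.interval y j).Nonempty

/-- `y'` arises from `y` by swapping the sensors `i < j`, which overlap and are in the wrong order
in `y`: in `y'` they are in the right order and together cover exactly what they covered in `y`;
no other sensor moves. -/
def IsSwap (y : Fin n → ℝ) (i j : Fin n) (y' : Fin n → ℝ) : Prop :=
  i < j ∧ y j < y i ∧ I.Overlap y i j ∧
    y' i < y' j ∧ I.interval y' i ∪ I.interval y' j = I.interval y i ∪ I.interval y j ∧
    ∀ k, k ≠ i → k ≠ j → y' k = y k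

/-- One step of the untangling process, on pairs (locations, set of active sensors): two active
sensors are swapped. The new active set is a minimal active set inside the old one: it is the old
one if that is still minimal, and otherwise sensors that have become superfluous stop being
active (and stay where they are). -/
def UntanglingStep (p q : (Fin n → ℝ) × Finset (Fin n)) : Prop :=
  (∃ i ∈ p.2, ∃ j ∈ p.2, I.IsSwap p.1 i j q.1) ∧ q.2 ⊆ p.2 ∧ I.IsMinimalActive q.1 q.2

/-- `z` results from `y`, with the active set `S`, by an untangling process that has run until all
overlapping active intervals are in order. -/
def IsUntangling (y : Fin n → ℝ) (S : Finset (Fin n)) (z : Fin n → ℝ) : Prop :=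
  ∃ T : Finset (Fin n), Relation.ReflTransGen I.UntanglingStep (y, S) (z, T) ∧
    ∀ i ∈ T, ∀ j ∈ T, i < j → I.Overlap z i j → z i < z j

/-- `ξ` is a `β`-balanced cost sharing scheme for an untangling `z` of `y`, where `S` is the active
set of `y`. -/
def IsBalancedScheme (y : Fin n → ℝ) (S : Finset (Fin n)) (z : Fin n → ℝ) (β : ℝ)
    (ξ : S → ℝ≥0) : Prop :=
  I.cost z ≤ ∑ i, (ξ i : ℝ) ∧ ∀ i : S, (ξ i : ℝ) ≤ β * |I.x i - y i|

end BarrierInstance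

/-!
Two facts carry the proof.

*Cost of a swap.* In a minimal active set no interval contains another, so its sensors are ordered
alike by centres, by left ends and by right ends. Swapping the overlapping sensors `i < j` with
`y j < y i` puts `i` at `y j + δ` and `j` at `y i + δ`, where `δ = r i - r j`: the two sensors
exchange their places and are both shifted by `δ`. As `x i ≤ x j`, the exchange does not raise the
cost, so a swap costs at most `2 |r i - r j|` (`cost_swap_le`), whatever the overlap. A swap
removes the inversion `(i, j)` and creates no new one (`inversions_swap_subset`), and as long as
there is an inversion, there is one between overlapping sensors (`exists_overlapping_inversion`). Hence
the process ends with no inversion at all, and the cost grows by at most the sum of `2 |r i - r j|`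
over the inversions of `y` (`exists_untangling`).

*Charging the inversions.* If `(i, j)` is an inversion, then
`y i - y j ≤ (y i - x i)⁺ + (x j - y j)⁺`; it is charged to the sensor with the larger summand `b`,
so that the other one stands at distance at most `2 b`. Let `m` be the smallest radius. The sensors at
distance at most `b` have every second interval disjoint, so there are at most `b / m + 1` of them.
A sensor at distance more than `b` must itself have moved away from the payer, and in an optimal
solution such a sensor does not overlap the next one, since it could move back a little;
so there are at most `b / (2 m) + 1` of these. As `|r i - r j|` is at most `(ρ - 1) m` and also at
most the distance of the two sensors, the payer is charged at most `(3 ρ + 3) b`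
(`sum_charge_le`). The cost of the untangling is therefore at most `(3 ρ + 4)` times that of `y`.
Since sensors outside `S` do not move in an optimal solution, the shares `(3 ρ + 4) |x i - y i|`
with `i ∈ S` pay for it.
-/

/-! ### Packing points on a line -/

/-- Points of `[u, v]` of which any two are at distance at least `w` number at most
`(v - u) / w + 1`. -/
theorem Finset.card_sub_one_mul_le_of_pairwise_separated {w u : ℝ} (hw : 0 ≤ w) (F : Finset ℝ) :
    ∀ v : ℝ, u ≤ v → (∀ p ∈ F, u ≤ p ∧ p ≤ v) → (∀ p ∈ F, ∀ q ∈ F, p < q → w ≤ q - p) →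
      w * ((F.card : ℝ) - 1) ≤ v - u := by
  induction F using Finset.induction_on_max with
  | empty => intro v huv _ _; rw [Finset.card_empty]; push_cast; linarith
  | insert a s ha ih =>
    intro v huv hF hsep
    have hns : a ∉ s := fun h => lt_irrefl _ (ha a h)
    rw [Finset.card_insert_of_notMem hns]
    have hav := (hF a (Finset.mem_insert_self a s)).2
    rcases s.eq_empty_or_nonempty with rfl | hne
    · simpa using huv
    · have hmem := s.max'_mem hne
      have h1 := hF _ (Finset.mem_insert_of_mem hmem)
      have h2 := hsep _ (Finset.mem_insert_of_mem hmem) a (Finset.mem_insert_self a s)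
        (ha _ hmem)
      have h3 := ih (s.max' hne) h1.1
        (fun p hp => ⟨(hF p (Finset.mem_insert_of_mem hp)).1, s.le_max' p hp⟩)
        (fun p hp q hq => hsep p (Finset.mem_insert_of_mem hp) q (Finset.mem_insert_of_mem hq))
      push_cast
      linarith

/-- Points of `[u, v]` such that any two with a third one between them are at distance at least
`2 * m` number at most `(v - u) / m + 2`. -/
theorem Finset.card_sub_two_mul_le_of_triple_separated {m u : ℝ} (hm : 0 ≤ m) (N : ℕ) :
    ∀ (F : Finset ℝ) (v : ℝ), F.card = N → u ≤ v → (∀ p ∈ F, u ≤ p ∧ p ≤ v) →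
      (∀ p ∈ F, ∀ q ∈ F, ∀ t ∈ F, p < q → q < t → 2 * m ≤ t - p) →
      m * ((N : ℝ) - 2) ≤ v - u := by
  induction N using Nat.strong_induction_on with
  | _ N ih =>
    intro F v hN huv hF hsep
    by_cases h2 : N ≤ 2
    · have : (N : ℝ) ≤ 2 := by exact_mod_cast h2
      nlinarith
    -- remove the two largest points `c > b` and compare with the largest remaining one, `a`
    have hne : F.Nonempty := Finset.card_pos.1 (by omega)
    set c := F.max' hne with hc
    have hcF : c ∈ F := F.max'_mem hne
    have hcard1 : (F.erase c).card = N - 1 := by rw [Finset.card_erase_of_mem hcF, hN]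
    have hne1 : (F.erase c).Nonempty := Finset.card_pos.1 (by omega)
    set b := (F.erase c).max' hne1 with hb
    have hbF : b ∈ F.erase c := Finset.max'_mem _ hne1
    have hcard2 : ((F.erase c).erase b).card = N - 2 := by
      rw [Finset.card_erase_of_mem hbF, hcard1]; omega
    have hne2 : ((F.erase c).erase b).Nonempty := Finset.card_pos.1 (by omega)
    set a := ((F.erase c).erase b).max' hne2 with ha
    have haF : a ∈ (F.erase c).erase b := Finset.max'_mem _ hne2
    have hbF' := Finset.mem_of_mem_erase hbF
    have haF' := Finset.mem_of_mem_erase (Finset.mem_of_mem_erase haF)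
    have hbc : b < c := lt_of_le_of_ne (F.le_max' b hbF') (Finset.ne_of_mem_erase hbF)
    have hab : a < b :=
      lt_of_le_of_ne (Finset.le_max' _ a (Finset.mem_of_mem_erase haF))
        (Finset.ne_of_mem_erase haF)
    have h3 := hsep a haF' b hbF' c hcF hab hbc
    have hsub : ∀ p ∈ (F.erase c).erase b, p ∈ F := fun p hp =>
      Finset.mem_of_mem_erase (Finset.mem_of_mem_erase hp)
    have h4 := ih (N - 2) (by omega) _ a hcard2 (hF a haF').1
      (fun p hp => ⟨(hF p (hsub p hp)).1, Finset.le_max' _ p hp⟩)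
      (fun p hp q hq t ht => hsep p (hsub p hp) q (hsub q hq) t (hsub t ht))
    rw [Nat.cast_sub (by omega)] at h4
    push_cast at h4
    have := (hF c hcF).2
    linarith

/-- The bound on what one sensor is charged. The sensors charged to it are indexed by `G`; the
distance to sensor `i` is `d i`, and `w i` stands for the difference of the two radii. -/
theorem sum_charge_le {ι : Type*} (G : Finset ι) (d w : ι → ℝ) {b m M : ℝ} (hm : 0 < m)
    (hb : 0 ≤ b) (hinj : Set.InjOn d G) (hpos : ∀ i ∈ G, 0 < d i) (hd : ∀ i ∈ G, d i ≤ 2 * b)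
    (hwd : ∀ i ∈ G, w i ≤ d i) (hw : ∀ i ∈ G, w i ≤ M - m) (hmM : m ≤ M)
    (htwo : ∀ i ∈ G, ∀ k ∈ G, d i < d k → 2 * m ≤ d k)
    (hthree : ∀ i ∈ G, ∀ k ∈ G, ∀ l ∈ G, d i < d k → d k < d l → 2 * m ≤ d l - d i)
    (hfar : ∀ i ∈ G, ∀ k ∈ G, b < d i → d i < d k → 2 * m ≤ d k - d i) :
    ∑ i ∈ G, 2 * w i ≤ (3 * (M / m) + 3) * b := by
  classical
  rw [← Finset.sum_filter_add_sum_filter_not G (fun i => d i ≤ b)]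
  set A := G.filter (fun i => d i ≤ b) with hA
  set B := G.filter (fun i => ¬ d i ≤ b) with hB
  have hAm : ∀ i ∈ A, i ∈ G ∧ d i ≤ b := fun i hi => Finset.mem_filter.1 hi
  have hBm : ∀ i ∈ B, i ∈ G ∧ b < d i := fun i hi => by
    have := Finset.mem_filter.1 hi; exact ⟨this.1, not_le.1 this.2⟩
  -- the payer itself, at distance `0`, takes part in the packing of the near sensors
  have hcardA : m * ((A.card : ℝ) - 1) ≤ b := by
    have h0 : (0 : ℝ) ∉ A.image d := by
      intro h
      obtain ⟨i, hi, h⟩ := Finset.mem_image.1 h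
      exact (hpos i (hAm i hi).1).ne' h
    have hc : (insert 0 (A.image d)).card = A.card + 1 := by
      rw [Finset.card_insert_of_notMem h0, Finset.card_image_of_injOn]
      exact hinj.mono fun i hi => (hAm i hi).1
    have key := Finset.card_sub_two_mul_le_of_triple_separated (u := 0) hm.le (A.card + 1)
      (insert 0 (A.image d)) b hc hb ?_ ?_
    · push_cast at key; linarith
    · intro p hp
      rcases Finset.mem_insert.1 hp with rfl | hp
      · exact ⟨le_rfl, hb⟩
      · obtain ⟨i, hi, rfl⟩ := Finset.mem_image.1 hp
        exact ⟨(hpos i (hAm i hi).1).le, (hAm i hi).2⟩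
    · have hnn : ∀ p ∈ insert 0 (A.image d), 0 ≤ p := by
        intro p hp
        rcases Finset.mem_insert.1 hp with rfl | hp
        · exact le_rfl
        · obtain ⟨i, hi, rfl⟩ := Finset.mem_image.1 hp
          exact (hpos i (hAm i hi).1).le
      have hex : ∀ p ∈ insert 0 (A.image d), 0 < p → ∃ i ∈ G, d i = p := by
        intro p hp hp0
        rcases Finset.mem_insert.1 hp with rfl | hp
        · exact absurd hp0 (lt_irrefl _)
        · obtain ⟨i, hi, rfl⟩ := Finset.mem_image.1 hp
          exact ⟨i, (hAm i hi).1, rfl⟩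
      intro p hp q hq t ht hpq hqt
      have hp0 := hnn p hp
      obtain ⟨k, hk, rfl⟩ := hex q hq (by linarith)
      obtain ⟨l, hl, rfl⟩ := hex t ht (by linarith)
      rcases hp0.eq_or_lt with rfl | hp0
      · simpa using htwo k hk l hl hqt
      · obtain ⟨i, hi, rfl⟩ := hex p hp hp0
        exact hthree i hi k hk l hl hpq hqt
  have hcardB : 2 * m * ((B.card : ℝ) - 1) ≤ b := by
    have hc : (B.image d).card = B.card :=
      Finset.card_image_of_injOn (hinj.mono fun i hi => (hBm i hi).1)
    have key := Finset.card_sub_one_mul_le_of_pairwise_separated (w := 2 * m) (u := b)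
      (by linarith) (B.image d) (2 * b) (by linarith) ?_ ?_
    · rw [hc] at key; linarith
    · intro p hp
      obtain ⟨i, hi, rfl⟩ := Finset.mem_image.1 hp
      exact ⟨(hBm i hi).2.le, hd i (hBm i hi).1⟩
    · intro p hp q hq hpq
      obtain ⟨i, hi, rfl⟩ := Finset.mem_image.1 hp
      obtain ⟨k, hk, rfl⟩ := Finset.mem_image.1 hq
      exact hfar i (hBm i hi).1 k (hBm k hk).1 (hBm i hi).2 hpq
  have hsA : ∑ i ∈ A, 2 * w i ≤ A.card * (2 * min b (M - m)) := by
    rw [← nsmul_eq_mul]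
    refine Finset.sum_le_card_nsmul _ _ _ fun i hi => ?_
    have := le_min ((hwd i (hAm i hi).1).trans (hAm i hi).2) (hw i (hAm i hi).1)
    linarith
  have hsB : ∑ i ∈ B, 2 * w i ≤ B.card * (2 * min (2 * b) (M - m)) := by
    rw [← nsmul_eq_mul]
    refine Finset.sum_le_card_nsmul _ _ _ fun i hi => ?_
    have := le_min ((hwd i (hBm i hi).1).trans (hd i (hBm i hi).1)) (hw i (hBm i hi).1)
    linarith
  have hx0 : 0 ≤ min b (M - m) := le_min hb (by linarith)
  have hz0 : 0 ≤ min (2 * b) (M - m) := le_min (by linarith) (by linarith)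
  have hx1 := min_le_left b (M - m)
  have hx2 := min_le_right b (M - m)
  have hz1 := min_le_left (2 * b) (M - m)
  have hz2 := min_le_right (2 * b) (M - m)
  generalize min b (M - m) = X at *
  generalize min (2 * b) (M - m) = Z at *
  -- multiply by `m` to clear the quotient
  have hmain : m * (∑ i ∈ A, 2 * w i + ∑ i ∈ B, 2 * w i) ≤ (3 * M + 3 * m) * b := by
    have e1 : m * A.card * X ≤ (b + m) * X :=
      mul_le_mul_of_nonneg_right (by linarith) hx0
    have e2 : 2 * m * B.card * Z ≤ (b + 2 * m) * Z :=
      mul_le_mul_of_nonneg_right (by linarith) hz0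
    have e3 := mul_le_mul_of_nonneg_left hsA hm.le
    have e4 := mul_le_mul_of_nonneg_left hsB hm.le
    have e5 := mul_le_mul_of_nonneg_left hx2 hb
    have e6 := mul_le_mul_of_nonneg_left hz2 hb
    have e7 := mul_le_mul_of_nonneg_left hx1 hm.le
    have e8 := mul_le_mul_of_nonneg_left hz1 hm.le
    nlinarith
  have hrw : (3 * (M / m) + 3) * b = ((3 * M + 3 * m) * b) / m := by field_simp
  rw [hrw, le_div_iff₀ hm]
  linarith

namespace BarrierInstance

variable {n : ℕ} (I : BarrierInstance n)

/-! ### Minimal active sets -/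

theorem mem_interval {y : Fin n → ℝ} {i : Fin n} {p : ℝ} :
    p ∈ I.interval y i ↔ y i - I.r i ≤ p ∧ p ≤ y i + I.r i := Iff.rfl

theorem isActive_iff {y : Fin n → ℝ} {S : Finset (Fin n)} :
    I.IsActive y S ↔
      ∀ p, 0 ≤ p → p ≤ I.L → ∃ i ∈ S, y i - I.r i ≤ p ∧ p ≤ y i + I.r i := by
  simp only [IsActive, Set.subset_def, Set.mem_Icc, Set.mem_iUnion, mem_interval, exists_prop,
    and_imp]

theorem isSolution_iff {y : Fin n → ℝ} :
    I.IsSolution y ↔ ∀ p, 0 ≤ p → p ≤ I.L → ∃ i, y i - I.r i ≤ p ∧ p ≤ y i + I.r i := by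
  simp only [IsSolution, Set.subset_def, Set.mem_Icc, Set.mem_iUnion, mem_interval, and_imp]

variable {I}

theorem IsActive.isSolution {y : Fin n → ℝ} {S : Finset (Fin n)} (h : I.IsActive y S) :
    I.IsSolution y := by
  rw [isActive_iff] at h
  rw [isSolution_iff]
  intro p h0 hL
  obtain ⟨i, -, hi⟩ := h p h0 hL
  exact ⟨i, hi⟩

theorem IsActive.exists_isMinimalActive {y : Fin n → ℝ} {S : Finset (Fin n)}
    (h : I.IsActive y S) : ∃ T ⊆ S, I.IsMinimalActive y T := by
  induction S using Finset.strongInduction with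
  | _ S ih =>
    by_cases hmin : ∀ T, T ⊂ S → ¬ I.IsActive y T
    · exact ⟨S, subset_rfl, h, hmin⟩
    · push Not at hmin
      obtain ⟨T, hTS, hT⟩ := hmin
      obtain ⟨U, hUT, hU⟩ := ih T hTS hT
      exact ⟨U, hUT.trans hTS.subset, hU⟩

/-- Every sensor of a minimal active set covers a point of the barrier that no other one covers. -/
theorem IsMinimalActive.exists_private {y : Fin n → ℝ} {S : Finset (Fin n)}
    (h : I.IsMinimalActive y S) {i : Fin n} (hi : i ∈ S) :
    ∃ p, 0 ≤ p ∧ p ≤ I.L ∧ (y i - I.r i ≤ p ∧ p ≤ y i + I.r i) ∧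
      ∀ k ∈ S, k ≠ i → ¬ (y k - I.r k ≤ p ∧ p ≤ y k + I.r k) := by
  classical
  have h1 := h.2 _ (Finset.erase_ssubset hi)
  rw [isActive_iff] at h1
  push Not at h1
  obtain ⟨p, h0, hL, hp⟩ := h1
  have hp' : ∀ k ∈ S, k ≠ i → ¬ (y k - I.r k ≤ p ∧ p ≤ y k + I.r k) := fun k hk hki hh =>
    absurd hh.2 (not_le.2 (hp k (Finset.mem_erase.2 ⟨hki, hk⟩) hh.1))
  obtain ⟨k, hk, hkp⟩ := I.isActive_iff.1 h.1 p h0 hL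
  by_cases hki : k = i
  · subst hki; exact ⟨p, h0, hL, hkp, hp'⟩
  · exact absurd hkp (hp' k hk hki)

/-- No interval of a minimal active set contains another one. -/
theorem IsMinimalActive.abs_radius_sub_lt {y : Fin n → ℝ} {S : Finset (Fin n)}
    (h : I.IsMinimalActive y S) {i j : Fin n} (hi : i ∈ S) (hj : j ∈ S) (hij : i ≠ j) :
    |I.r i - I.r j| < |y i - y j| := by
  have key : ∀ i ∈ S, ∀ j ∈ S, i ≠ j → I.r j - I.r i < |y i - y j| := by
    intro i hi j hj hij
    by_contra! hc
    obtain ⟨p, -, -, ⟨h1, h2⟩, h3⟩ := h.exists_private hi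
    have := abs_le.1 hc
    exact h3 j hj hij.symm ⟨by linarith, by linarith⟩
  have h1 := key i hi j hj hij
  have h2 := key j hj i hi hij.symm
  rw [abs_sub_comm] at h2
  exact abs_lt.2 ⟨by linarith, by linarith⟩

theorem IsMinimalActive.injOn {y : Fin n → ℝ} {S : Finset (Fin n)}
    (h : I.IsMinimalActive y S) : Set.InjOn y S := by
  intro i hi j hj hij
  by_contra hne
  have := h.abs_radius_sub_lt hi hj hne
  rw [hij, sub_self, abs_zero] at this
  exact absurd this (not_lt.2 (abs_nonneg _))

theorem IsMinimalActive.left_lt_iff {y : Fin n → ℝ} {S : Finset (Fin n)}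
    (h : I.IsMinimalActive y S) {i j : Fin n} (hi : i ∈ S) (hj : j ∈ S) :
    y i - I.r i < y j - I.r j ↔ y i < y j := by
  by_cases hij : i = j
  · subst hij; simp
  have h1 := h.abs_radius_sub_lt hi hj hij
  have h2 := abs_lt.1 h1
  rcases abs_cases (y i - y j) with h3 | h3 <;> constructor <;> intro h4 <;> linarith

theorem IsMinimalActive.right_lt_iff {y : Fin n → ℝ} {S : Finset (Fin n)}
    (h : I.IsMinimalActive y S) {i j : Fin n} (hi : i ∈ S) (hj : j ∈ S) :
    y i + I.r i < y j + I.r j ↔ y i < y j := by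
  by_cases hij : i = j
  · subst hij; simp
  have h1 := h.abs_radius_sub_lt hi hj hij
  have h2 := abs_lt.1 h1
  rcases abs_cases (y i - y j) with h3 | h3 <;> constructor <;> intro h4 <;> linarith

/-- If a third sensor stands between two sensors of a minimal active set, then the two are disjoint,
as they would make the third one superfluous otherwise. -/
theorem IsMinimalActive.right_lt_left {y : Fin n → ℝ} {S : Finset (Fin n)}
    (h : I.IsMinimalActive y S) {i j k : Fin n} (hi : i ∈ S) (hj : j ∈ S) (hk : k ∈ S)
    (hij : y i < y j) (hjk : y j < y k) : y i + I.r i < y k - I.r k := by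
  by_contra! hc
  obtain ⟨p, -, -, ⟨h1, h2⟩, h3⟩ := h.exists_private hj
  have hl := (h.left_lt_iff hi hj).2 hij
  have hr := (h.right_lt_iff hj hk).2 hjk
  rcases le_total p (y i + I.r i) with hp | hp
  · exact h3 i hi (fun e => hij.ne (congrArg y e)) ⟨by linarith, hp⟩
  · exact h3 k hk (fun e => hjk.ne (congrArg y e).symm) ⟨by linarith, by linarith⟩

variable (I) in
theorem overlap_iff_of_lt {y : Fin n → ℝ} {i j : Fin n} (hji : y j < y i) :
    I.Overlap y i j ↔ y i - I.r i ≤ y j + I.r j := by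
  have hi := I.r_pos i
  have hj := I.r_pos j
  constructor
  · rintro ⟨p, hp1, hp2⟩
    exact hp1.1.trans hp2.2
  · intro h
    refine ⟨max (y i - I.r i) (y j - I.r j), ?_, ?_⟩ <;> rw [mem_interval]
    · exact ⟨le_max_left _ _, max_le (by linarith) (by linarith)⟩
    · exact ⟨le_max_right _ _, max_le h (by linarith)⟩

/-! ### Untangling -/

/-- The pairs of sensors of `S` that are in the wrong order. -/
noncomputable def inversions (y : Fin n → ℝ) (S : Finset (Fin n)) : Finset (Fin n × Fin n) :=
  (S ×ˢ S).filter fun e => e.1 < e.2 ∧ y e.2 < y e.1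

theorem mem_inversions {y : Fin n → ℝ} {S : Finset (Fin n)} {e : Fin n × Fin n} :
    e ∈ inversions y S ↔ (e.1 ∈ S ∧ e.2 ∈ S) ∧ e.1 < e.2 ∧ y e.2 < y e.1 := by
  simp [inversions]

/-- A closest inversion overlaps: a point in a gap between its two sensors would be
covered by a third one, which forms a closer inversion with one of them. -/
theorem IsMinimalActive.exists_overlapping_inversion {y : Fin n → ℝ} {S : Finset (Fin n)}
    (h : I.IsMinimalActive y S) (hne : (inversions y S).Nonempty) :
    ∃ e ∈ inversions y S, I.Overlap y e.1 e.2 := by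
  obtain ⟨⟨i, j⟩, he, hmin⟩ :=
    Finset.exists_min_image (inversions y S) (fun e => y e.1 - y e.2) hne
  refine ⟨(i, j), he, ?_⟩
  obtain ⟨⟨hi, hj⟩, hij, hji⟩ := mem_inversions.1 he
  dsimp only at hi hj hij hji hmin ⊢
  rw [I.overlap_iff_of_lt hji]
  by_contra! hc
  obtain ⟨p, -, hpL, ⟨hp, -⟩, -⟩ := h.exists_private hi
  obtain ⟨q, hq0, -, ⟨-, hq⟩, -⟩ := h.exists_private hj
  obtain ⟨g, hg1, hg2⟩ := exists_between hc
  obtain ⟨k, hk, hk1, hk2⟩ := I.isActive_iff.1 h.1 g (by linarith) (by linarith)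
  have hki : y k < y i := (h.left_lt_iff hk hi).1 (by linarith)
  have hjk : y j < y k := (h.right_lt_iff hj hk).1 (by linarith)
  rcases lt_trichotomy k i with hlt | heq | hgt
  · have := hmin (k, j) (mem_inversions.2 ⟨⟨hk, hj⟩, hlt.trans hij, hjk⟩)
    dsimp only at this
    linarith
  · exact hki.ne (congrArg y heq)
  · have := hmin (i, k) (mem_inversions.2 ⟨⟨hi, hk⟩, hgt, hki⟩)
    dsimp only at this
    linarith

variable (I) in
/-- The locations after swapping `i` and `j`: they exchange their places and are both shifted by
the difference of their radii, so that the left end of `j` becomes the left end of `i` and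
the right end of `i` becomes the right end of `j`. -/
noncomputable def swap (y : Fin n → ℝ) (i j : Fin n) : Fin n → ℝ :=
  Function.update (Function.update y i (y j + (I.r i - I.r j))) j (y i + (I.r i - I.r j))

theorem swap_left {y : Fin n → ℝ} {i j : Fin n} (hij : i ≠ j) :
    I.swap y i j i = y j + (I.r i - I.r j) := by
  simp [swap, hij]

theorem swap_right {y : Fin n → ℝ} {i j : Fin n} :
    I.swap y i j j = y i + (I.r i - I.r j) := by
  simp [swap]

theorem swap_of_ne {y : Fin n → ℝ} {i j k : Fin n} (hi : k ≠ i) (hj : k ≠ j) :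
    I.swap y i j k = y k := by
  simp [swap, hi, hj]

theorem IsMinimalActive.isSwap_swap {y : Fin n → ℝ} {S : Finset (Fin n)}
    (h : I.IsMinimalActive y S) {i j : Fin n} (hi : i ∈ S) (hj : j ∈ S) (hij : i < j)
    (hji : y j < y i) (ho : I.Overlap y i j) : I.IsSwap y i j (I.swap y i j) := by
  refine ⟨hij, hji, ho, ?_, ?_, fun k hki hkj => swap_of_ne hki hkj⟩
  · rw [swap_left hij.ne, swap_right]; linarith
  · rw [I.overlap_iff_of_lt hji] at ho
    have h1 := h.abs_radius_sub_lt hi hj hij.ne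
    rw [abs_of_pos (sub_pos.2 hji)] at h1
    have h2 := abs_lt.1 h1
    have hri := I.r_pos i
    have hrj := I.r_pos j
    ext p
    simp only [Set.mem_union, mem_interval, swap_left hij.ne, swap_right]
    -- both unions are the interval from `y j - r j` to `y i + r i`
    constructor
    · intro hp
      rcases le_total p (y j + I.r j) with hp' | hp'
      · right
        rcases hp with hp | hp <;> exact ⟨by linarith, by linarith⟩
      · left
        rcases hp with hp | hp <;> exact ⟨by linarith, by linarith⟩
    · intro hp
      rcases le_total p (y j + (I.r i - I.r j) + I.r i) with hp' | hp'
      · left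
        rcases hp with hp | hp <;> exact ⟨by linarith, by linarith⟩
      · right
        rcases hp with hp | hp <;> exact ⟨by linarith, by linarith⟩

theorem IsSwap.isActive {y y' : Fin n → ℝ} {S : Finset (Fin n)} {i j : Fin n}
    (hs : I.IsSwap y i j y') (hi : i ∈ S) (hj : j ∈ S) (h : I.IsActive y S) :
    I.IsActive y' S := by
  obtain ⟨-, -, -, -, hU, hk⟩ := hs
  intro p hp
  obtain ⟨k, hkS, hkp⟩ := Set.mem_iUnion₂.1 (h hp)
  by_cases hkij : k = i ∨ k = j
  · have : p ∈ I.interval y' i ∪ I.interval y' j := by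
      rw [hU]
      rcases hkij with rfl | rfl
      · exact Or.inl hkp
      · exact Or.inr hkp
    rcases this with hp | hp
    · exact Set.mem_iUnion₂.2 ⟨i, hi, hp⟩
    · exact Set.mem_iUnion₂.2 ⟨j, hj, hp⟩
  · push Not at hkij
    refine Set.mem_iUnion₂.2 ⟨k, hkS, ?_⟩
    rw [interval, hk k hkij.1 hkij.2]
    exact hkp

/-- A swap creates no inversion. The sensor `i` inherits the left end of `j`, and in a minimal
active set the order of the sensors is that of their left ends; so for the others it now stands
where `j` stood, which is on the same side as before because no sensor stands between `i` and
`j`. The same holds for `j` with right ends. -/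
theorem IsMinimalActive.inversions_swap_subset {y : Fin n → ℝ} {S T : Finset (Fin n)}
    (h : I.IsMinimalActive y S) {i j : Fin n} (hi : i ∈ S) (hj : j ∈ S) (hij : i < j)
    (hji : y j < y i) (ho : I.Overlap y i j) (hTS : T ⊆ S)
    (hT : I.IsMinimalActive (I.swap y i j) T) :
    inversions (I.swap y i j) T ⊆ (inversions y S).erase (i, j) := by
  rw [I.overlap_iff_of_lt hji] at ho
  have hside : ∀ k ∈ S, k ≠ i → k ≠ j → y k < y j ∨ y i < y k := by
    intro k hk hki hkj
    by_contra! hc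
    have h1 : y j < y k := lt_of_le_of_ne hc.1 fun e => hkj (h.injOn hk hj e.symm)
    have h2 : y k < y i := lt_of_le_of_ne hc.2 fun e => hki (h.injOn hk hi e)
    have := h.right_lt_left hj hk hi h1 h2
    linarith
  have hl := swap_left (I := I) (y := y) hij.ne
  have hr := swap_right (I := I) (y := y) (i := i) (j := j)
  rintro ⟨k, l⟩ he
  obtain ⟨⟨hk, hl'⟩, hkl, hlk⟩ := mem_inversions.1 he
  dsimp only at hk hl' hkl hlk
  have hkS := hTS hk
  have hlS := hTS hl'
  have hne : (k, l) ≠ (i, j) := by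
    intro e
    obtain ⟨rfl, rfl⟩ := Prod.mk.inj e
    rw [hl, hr] at hlk
    linarith
  refine Finset.mem_erase.2 ⟨hne, mem_inversions.2 ⟨⟨hkS, hlS⟩, hkl, ?_⟩⟩
  dsimp only
  have hleft := (hT.left_lt_iff hl' hk).2 hlk
  have hright := (hT.right_lt_iff hl' hk).2 hlk
  by_cases hki : k = i
  · subst hki
    have hlj : l ≠ j := fun e => hne (by rw [e])
    rw [hl, swap_of_ne hkl.ne' hlj] at hleft
    exact ((h.left_lt_iff hlS hj).1 (by linarith)).trans hji
  by_cases hkj : k = j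
  · subst hkj
    have hli : l ≠ i := fun e => by subst e; exact lt_asymm hkl hij
    rw [hr, swap_of_ne hli hkl.ne'] at hright
    have h1 : y l < y i := (h.right_lt_iff hlS hi).1 (by linarith)
    rcases hside l hlS hli hkl.ne' with h2 | h2
    · exact h2
    · exact absurd h1 (lt_asymm h2)
  by_cases hli : l = i
  · subst hli
    rw [hl, swap_of_ne hki hkj] at hleft
    have h1 : y j < y k := (h.left_lt_iff hj hkS).1 (by linarith)
    rcases hside k hkS hki hkj with h2 | h2
    · exact absurd h1 (lt_asymm h2)
    · exact h2
  by_cases hlj : l = j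
  · subst hlj
    rw [hr, swap_of_ne hki hkj] at hright
    exact hji.trans ((h.right_lt_iff hi hkS).1 (by linarith))
  rwa [swap_of_ne hli hlj, swap_of_ne hki hkj] at hlk

theorem cost_swap_le {y : Fin n → ℝ} {i j : Fin n} (hij : i < j) (hji : y j < y i) :
    I.cost (I.swap y i j) ≤ I.cost y + 2 * |I.r i - I.r j| := by
  have hx := I.x_mono hij.le
  have hsplit : ∀ f : Fin n → ℝ,
      ∑ k, f k = f i + (f j + ∑ k ∈ (Finset.univ.erase i).erase j, f k) := by
    intro f
    rw [Finset.add_sum_erase _ _ (Finset.mem_erase.2 ⟨hij.ne', Finset.mem_univ j⟩),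
      Finset.add_sum_erase _ _ (Finset.mem_univ i)]
  unfold cost
  rw [hsplit, hsplit fun k => |y k - I.x k|]
  have hrest : ∑ k ∈ (Finset.univ.erase i).erase j, |I.swap y i j k - I.x k|
      = ∑ k ∈ (Finset.univ.erase i).erase j, |y k - I.x k| := by
    refine Finset.sum_congr rfl fun k hk => ?_
    rw [swap_of_ne (Finset.ne_of_mem_erase (Finset.mem_of_mem_erase hk))
      (Finset.ne_of_mem_erase hk)]
  rw [hrest, swap_left hij.ne, swap_right]
  have e1 : |y j + (I.r i - I.r j) - I.x i| ≤ |y j - I.x i| + |I.r i - I.r j| := by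
    rw [add_sub_right_comm]; exact abs_add_le _ _
  have e2 : |y i + (I.r i - I.r j) - I.x j| ≤ |y i - I.x j| + |I.r i - I.r j| := by
    rw [add_sub_right_comm]; exact abs_add_le _ _
  -- exchanging the places puts the two sensors in the order of their initial locations
  have e3 : |y j - I.x i| + |y i - I.x j| ≤ |y i - I.x i| + |y j - I.x j| := by
    rcases abs_cases (y j - I.x i) with a | a <;> rcases abs_cases (y i - I.x j) with b | b <;>
      rcases abs_cases (y i - I.x i) with c | c <;> rcases abs_cases (y j - I.x j) with d | d <;>
      linarith
  linarith

/-- Every minimal active set can be untangled until it has no inversion left, at a cost that is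
bounded by the inversions it had. -/
theorem IsMinimalActive.exists_untangling {y : Fin n → ℝ} {S : Finset (Fin n)}
    (h : I.IsMinimalActive y S) :
    ∃ z T, Relation.ReflTransGen I.UntanglingStep (y, S) (z, T) ∧ I.IsMinimalActive z T ∧
      inversions z T = ∅ ∧
      I.cost z ≤ I.cost y + ∑ e ∈ inversions y S, 2 * |I.r e.1 - I.r e.2| := by
  induction hN : (inversions y S).card using Nat.strong_induction_on generalizing y S with
  | _ N ih =>
    subst hN
    rcases (inversions y S).eq_empty_or_nonempty with h0 | hne
    · exact ⟨y, S, Relation.ReflTransGen.refl, h, h0, by simp [h0]⟩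
    obtain ⟨⟨i, j⟩, he, ho⟩ := h.exists_overlapping_inversion hne
    obtain ⟨⟨hi, hj⟩, hij, hji⟩ := mem_inversions.1 he
    dsimp only at hi hj hij hji ho
    have hs := h.isSwap_swap hi hj hij hji ho
    obtain ⟨T, hTS, hT⟩ := (hs.isActive hi hj h.1).exists_isMinimalActive
    have hsub := h.inversions_swap_subset hi hj hij hji ho hTS hT
    obtain ⟨z, U, hzU, hU, hU0, hcost⟩ := ih _
      ((Finset.card_le_card hsub).trans_lt (Finset.card_erase_lt_of_mem he)) hT rfl
    have hstep : I.UntanglingStep (y, S) (I.swap y i j, T) := ⟨⟨i, hi, j, hj, hs⟩, hTS, hT⟩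
    refine ⟨z, U, Relation.ReflTransGen.head hstep hzU, hU, hU0, ?_⟩
    have h1 : ∑ e ∈ inversions (I.swap y i j) T, 2 * |I.r e.1 - I.r e.2| ≤
        ∑ e ∈ (inversions y S).erase (i, j), 2 * |I.r e.1 - I.r e.2| :=
      Finset.sum_le_sum_of_subset_of_nonneg hsub fun e _ _ => by positivity
    have h2 := Finset.add_sum_erase _ (fun e : Fin n × Fin n => 2 * |I.r e.1 - I.r e.2|) he
    have h3 := cost_swap_le (I := I) hij hji
    dsimp only at h2
    linarith

/-! ### Optimal solutions -/

theorem IsOptimal.not_isSolution_update {y : Fin n → ℝ} (hy : I.IsOptimal y) {k : Fin n} {t : ℝ}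
    (ht : |t - I.x k| < |y k - I.x k|) : ¬ I.IsSolution (Function.update y k t) := by
  intro hsol
  refine absurd (hy.2 _ hsol) (not_le.2 ?_)
  refine Finset.sum_lt_sum (fun i _ => ?_) ⟨k, Finset.mem_univ k, by simpa using ht⟩
  by_cases hik : i = k
  · subst hik; simpa using ht.le
  · simp [hik]

theorem IsOptimal.eq_of_notMem {y : Fin n → ℝ} (hy : I.IsOptimal y) {S : Finset (Fin n)}
    (hS : I.IsActive y S) {k : Fin n} (hk : k ∉ S) : y k = I.x k := by
  by_contra hne
  refine hy.not_isSolution_update (k := k) (t := I.x k)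
    (by simpa using sub_ne_zero.2 hne) (IsActive.isSolution (S := S) ?_)
  rw [isActive_iff] at hS ⊢
  intro p h0 hL
  obtain ⟨i, hi, hip⟩ := hS p h0 hL
  refine ⟨i, hi, ?_⟩
  have hik : i ≠ k := fun e => hk (e ▸ hi)
  rwa [Function.update_of_ne hik]

/-- A sensor that has moved to the right does not overlap a sensor on its right, since it could
move back a little. -/
theorem IsOptimal.right_le_left_of_lt {y : Fin n → ℝ} (hy : I.IsOptimal y) {S : Finset (Fin n)}
    (hS : I.IsMinimalActive y S) {i k : Fin n} (hi : i ∈ S) (hk : k ∈ S) (hx : I.x i < y i)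
    (hik : y i < y k) : y i + I.r i ≤ y k - I.r k := by
  by_contra! hc
  have hki : k ≠ i := fun e => hik.ne' (congrArg y e)
  have hright := (hS.right_lt_iff hi hk).2 hik
  set t := max (I.x i) (y k - I.r k - I.r i) with ht
  have ht1 : I.x i ≤ t := le_max_left _ _
  have ht2 : y k - I.r k - I.r i ≤ t := le_max_right _ _
  have ht3 : t < y i := max_lt hx (by linarith)
  refine hy.not_isSolution_update (k := i) (t := t) ?_ (IsActive.isSolution (S := S) ?_)
  · rw [abs_of_nonneg (by linarith), abs_of_pos (by linarith)]; linarith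
  rw [isActive_iff]
  intro p h0 hL
  obtain ⟨l, hl, hlp⟩ := I.isActive_iff.1 hS.1 p h0 hL
  by_cases hli : l = i
  · subst hli
    rcases le_total p (t + I.r l) with hp | hp
    · exact ⟨l, hl, by rw [Function.update_self]; exact ⟨by linarith, hp⟩⟩
    · exact ⟨k, hk, by rw [Function.update_of_ne hki]; exact ⟨by linarith, by linarith⟩⟩
  · exact ⟨l, hl, by rwa [Function.update_of_ne hli]⟩

/-- A sensor that has moved to the left does not overlap a sensor on its left. -/
theorem IsOptimal.right_le_left_of_gt {y : Fin n → ℝ} (hy : I.IsOptimal y) {S : Finset (Fin n)}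
    (hS : I.IsMinimalActive y S) {i k : Fin n} (hi : i ∈ S) (hk : k ∈ S) (hx : y i < I.x i)
    (hki : y k < y i) : y k + I.r k ≤ y i - I.r i := by
  by_contra! hc
  have hne : k ≠ i := fun e => hki.ne (congrArg y e)
  have hleft := (hS.left_lt_iff hk hi).2 hki
  set t := min (I.x i) (y k + I.r k + I.r i) with ht
  have ht1 : t ≤ I.x i := min_le_left _ _
  have ht2 : t ≤ y k + I.r k + I.r i := min_le_right _ _
  have ht3 : y i < t := lt_min hx (by linarith)
  refine hy.not_isSolution_update (k := i) (t := t) ?_ (IsActive.isSolution (S := S) ?_)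
  · rw [abs_of_nonpos (by linarith), abs_of_neg (by linarith)]; linarith
  rw [isActive_iff]
  intro p h0 hL
  obtain ⟨l, hl, hlp⟩ := I.isActive_iff.1 hS.1 p h0 hL
  by_cases hli : l = i
  · subst hli
    rcases le_total (t - I.r l) p with hp | hp
    · exact ⟨l, hl, by rw [Function.update_self]; exact ⟨hp, by linarith⟩⟩
    · exact ⟨k, hk, by rw [Function.update_of_ne hne]; exact ⟨by linarith, by linarith⟩⟩
  · exact ⟨l, hl, by rwa [Function.update_of_ne hli]⟩

/-! ### Charging the inversions -/

theorem radius_le_iSup (i : Fin n) : I.r i ≤ ⨆ k, I.r k :=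
  le_ciSup (Set.finite_range I.r).bddAbove i

theorem iInf_le_radius (i : Fin n) : ⨅ k, I.r k ≤ I.r i :=
  ciInf_le (Set.finite_range I.r).bddBelow i

variable (I) in
theorem iInf_radius_pos [Nonempty (Fin n)] : 0 < ⨅ k, I.r k := by
  obtain ⟨i, hi⟩ := exists_eq_ciInf_of_finite (f := I.r)
  rw [← hi]
  exact I.r_pos i

theorem abs_radius_sub_le (i j : Fin n) :
    |I.r i - I.r j| ≤ (⨆ k, I.r k) - ⨅ k, I.r k := by
  have h1 := I.radius_le_iSup i
  have h2 := I.radius_le_iSup j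
  have h3 := I.iInf_le_radius i
  have h4 := I.iInf_le_radius j
  exact abs_le.2 ⟨by linarith, by linarith⟩

/-- The inversions charged to `j` as the sensor with the larger index. -/
theorem IsOptimal.sum_charged_left_le {y : Fin n → ℝ} (hy : I.IsOptimal y)
    {S : Finset (Fin n)} (hS : I.IsMinimalActive y S) {j : Fin n} (hj : j ∈ S)
    (G : Finset (Fin n))
    (hG : ∀ i ∈ G, i ∈ S ∧ i < j ∧ y j < y i ∧ max (y i - I.x i) 0 ≤ max (I.x j - y j) 0) :
    ∑ i ∈ G, 2 * |I.r i - I.r j| ≤ (3 * I.rho + 3) * max (I.x j - y j) 0 := by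
  have : Nonempty (Fin n) := ⟨j⟩
  have hdist : ∀ i ∈ G, y i - y j ≤ max (y i - I.x i) 0 + max (I.x j - y j) 0 := by
    intro i hi
    have := I.x_mono (hG i hi).2.1.le
    have h1 := le_max_left (y i - I.x i) 0
    have h2 := le_max_left (I.x j - y j) 0
    linarith
  have hm := fun i => I.iInf_le_radius i
  refine sum_charge_le G (fun i => y i - y j) _ I.iInf_radius_pos (le_max_right _ _) ?_ ?_ ?_ ?_ ?_
    ((I.iInf_le_radius j).trans (I.radius_le_iSup j)) ?_ ?_ ?_
  · intro i hi k hk e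
    exact hS.injOn (hG i hi).1 (hG k hk).1 (sub_left_injective e)
  · intro i hi
    exact sub_pos.2 (hG i hi).2.2.1
  · intro i hi
    have h1 := hdist i hi
    have h2 := (hG i hi).2.2.2
    linarith
  · intro i hi
    have h1 := hS.abs_radius_sub_lt (hG i hi).1 hj (hG i hi).2.1.ne
    rw [abs_of_pos (a := y i - y j) (sub_pos.2 (hG i hi).2.2.1)] at h1
    exact h1.le
  · intro i hi
    exact abs_radius_sub_le i j
  · intro i hi k hk hik
    have := hS.right_lt_left hj (hG i hi).1 (hG k hk).1 (hG i hi).2.2.1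
      (sub_lt_sub_iff_right _ |>.1 hik)
    linarith [hm j, hm k]
  · intro i hi k hk l hl hik hkl
    have := hS.right_lt_left (hG i hi).1 (hG k hk).1 (hG l hl).1
      (sub_lt_sub_iff_right _ |>.1 hik) (sub_lt_sub_iff_right _ |>.1 hkl)
    linarith [hm i, hm l]
  · intro i hi k hk hbi hik
    have hx : I.x i < y i := by
      have h1 := hdist i hi
      by_contra! hc
      rw [max_eq_right (a := y i - I.x i) (by linarith)] at h1
      linarith
    have := hy.right_le_left_of_lt hS (hG i hi).1 (hG k hk).1 hx
      (sub_lt_sub_iff_right _ |>.1 hik)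
    linarith [hm i, hm k]

/-- The inversions charged to `i` as the sensor with the smaller index. -/
theorem IsOptimal.sum_charged_right_le {y : Fin n → ℝ} (hy : I.IsOptimal y)
    {S : Finset (Fin n)} (hS : I.IsMinimalActive y S) {i : Fin n} (hi : i ∈ S)
    (G : Finset (Fin n))
    (hG : ∀ j ∈ G, j ∈ S ∧ i < j ∧ y j < y i ∧ max (I.x j - y j) 0 ≤ max (y i - I.x i) 0) :
    ∑ j ∈ G, 2 * |I.r i - I.r j| ≤ (3 * I.rho + 3) * max (y i - I.x i) 0 := by
  have : Nonempty (Fin n) := ⟨i⟩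
  have hdist : ∀ j ∈ G, y i - y j ≤ max (y i - I.x i) 0 + max (I.x j - y j) 0 := by
    intro j hj
    have := I.x_mono (hG j hj).2.1.le
    have h1 := le_max_left (y i - I.x i) 0
    have h2 := le_max_left (I.x j - y j) 0
    linarith
  have hm := fun i => I.iInf_le_radius i
  refine sum_charge_le G (fun j => y i - y j) _ I.iInf_radius_pos (le_max_right _ _) ?_ ?_ ?_ ?_ ?_
    ((I.iInf_le_radius i).trans (I.radius_le_iSup i)) ?_ ?_ ?_
  · intro j hj k hk e
    exact hS.injOn (hG j hj).1 (hG k hk).1 (sub_right_injective e)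
  · intro j hj
    exact sub_pos.2 (hG j hj).2.2.1
  · intro j hj
    have h1 := hdist j hj
    have h2 := (hG j hj).2.2.2
    linarith
  · intro j hj
    have h1 := hS.abs_radius_sub_lt hi (hG j hj).1 (hG j hj).2.1.ne
    rw [abs_of_pos (a := y i - y j) (sub_pos.2 (hG j hj).2.2.1)] at h1
    exact h1.le
  · intro j hj
    exact abs_radius_sub_le i j
  · intro j hj k hk hjk
    have := hS.right_lt_left (hG k hk).1 (hG j hj).1 hi (sub_lt_sub_iff_left _ |>.1 hjk)
      (hG j hj).2.2.1
    linarith [hm i, hm k]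
  · intro j hj k hk l hl hjk hkl
    have := hS.right_lt_left (hG l hl).1 (hG k hk).1 (hG j hj).1
      (sub_lt_sub_iff_left _ |>.1 hkl) (sub_lt_sub_iff_left _ |>.1 hjk)
    linarith [hm j, hm l]
  · intro j hj k hk hbj hjk
    have hx : y j < I.x j := by
      have h1 := hdist j hj
      by_contra! hc
      rw [max_eq_right (a := I.x j - y j) (by linarith)] at h1
      linarith
    have := hy.right_le_left_of_gt hS (hG j hj).1 (hG k hk).1 hx
      (sub_lt_sub_iff_left _ |>.1 hjk)
    linarith [hm j, hm k]

theorem IsOptimal.sum_inversions_le {y : Fin n → ℝ} (hy : I.IsOptimal y)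
    {S : Finset (Fin n)} (hS : I.IsMinimalActive y S) :
    ∑ e ∈ inversions y S, 2 * |I.r e.1 - I.r e.2| ≤
      (3 * I.rho + 3) * ∑ i ∈ S, |y i - I.x i| := by
  classical
  let P : Fin n × Fin n → Prop := fun e => max (y e.1 - I.x e.1) 0 ≤ max (I.x e.2 - y e.2) 0
  have hL : ∑ e ∈ (inversions y S).filter P, 2 * |I.r e.1 - I.r e.2| ≤
      ∑ j ∈ S, (3 * I.rho + 3) * max (I.x j - y j) 0 := by
    have e1 : ∑ e ∈ (inversions y S).filter P, 2 * |I.r e.1 - I.r e.2| =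
        ∑ j ∈ S, ∑ i ∈ S.filter (fun i => (i < j ∧ y j < y i) ∧ P (i, j)),
          2 * |I.r i - I.r j| := by
      simp only [inversions, Finset.sum_filter, Finset.sum_product_right, ite_and]
    rw [e1]
    refine Finset.sum_le_sum fun j hj => hy.sum_charged_left_le hS hj _ fun i hi => ?_
    obtain ⟨hiS, ⟨h1, h2⟩, h3⟩ := Finset.mem_filter.1 hi
    exact ⟨hiS, h1, h2, h3⟩
  have hR : ∑ e ∈ (inversions y S).filter (fun e => ¬ P e), 2 * |I.r e.1 - I.r e.2| ≤
      ∑ i ∈ S, (3 * I.rho + 3) * max (y i - I.x i) 0 := by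
    have e1 : ∑ e ∈ (inversions y S).filter (fun e => ¬ P e), 2 * |I.r e.1 - I.r e.2| =
        ∑ i ∈ S, ∑ j ∈ S.filter (fun j => (i < j ∧ y j < y i) ∧ ¬ P (i, j)),
          2 * |I.r i - I.r j| := by
      simp only [inversions, Finset.sum_filter, Finset.sum_product, ite_and]
    rw [e1]
    refine Finset.sum_le_sum fun i hi => hy.sum_charged_right_le hS hi _ fun j hj => ?_
    obtain ⟨hjS, ⟨h1, h2⟩, h3⟩ := Finset.mem_filter.1 hj
    exact ⟨hjS, h1, h2, (not_le.1 h3).le⟩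
  rw [← Finset.sum_filter_add_sum_filter_not _ P]
  refine (add_le_add hL hR).trans_eq ?_
  rw [← Finset.sum_add_distrib, Finset.mul_sum]
  refine Finset.sum_congr rfl fun i _ => ?_
  rw [← mul_add]
  congr 1
  rcases le_total (y i) (I.x i) with h | h
  · rw [max_eq_left (by linarith), max_eq_right (by linarith), abs_of_nonpos (by linarith)]
    ring
  · rw [max_eq_right (by linarith), max_eq_left (by linarith), abs_of_nonneg (by linarith)]
    ring

theorem rho_nonneg : 0 ≤ I.rho :=
  div_nonneg (Real.iSup_nonneg fun i => (I.r_pos i).le) (Real.iInf_nonneg fun i => (I.r_pos i).le)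

end BarrierInstance

theorem mainTheorem4 {n : ℕ} (I : BarrierInstance n) (y : Fin n → ℝ) (hy : I.IsOptimal y)
    (S : Finset (Fin n)) (hS : I.IsMinimalActive y S) :
    ∃ z : Fin n → ℝ, I.IsUntangling y S z ∧
      (∃ ξ : S → ℝ≥0, I.IsBalancedScheme y S z (3 * I.rho + 4) ξ) ∧
      I.IsOrderPreserving z ∧ I.IsApproximate (3 * I.rho + 4) z := by
  obtain ⟨z, T, hzT, hT, h0, hcost⟩ := hS.exists_untangling
  have hρ := I.rho_nonneg
  have hord : ∀ i ∈ T, ∀ j ∈ T, i < j → z i < z j := by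
    intro i hi j hj hij
    by_contra! hc
    have hlt : z j < z i := lt_of_le_of_ne hc fun e => hij.ne' (hT.injOn hj hi e)
    have : (i, j) ∈ BarrierInstance.inversions z T :=
      BarrierInstance.mem_inversions.2 ⟨⟨hi, hj⟩, hij, hlt⟩
    simp [h0] at this
  have hyS : I.cost y = ∑ i ∈ S, |y i - I.x i| := by
    refine (Finset.sum_subset (Finset.subset_univ S) fun k _ hk => ?_).symm
    rw [hy.eq_of_notMem hS.1 hk, sub_self, abs_zero]
  have hle : I.cost z ≤ (3 * I.rho + 4) * I.cost y := by
    have := hy.sum_inversions_le hS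
    rw [← hyS] at this
    linarith
  refine ⟨z, ⟨T, hzT, fun i hi j hj hij _ => hord i hi j hj hij⟩, ?_, ⟨T, hT.1, hord⟩,
    hT.1.isSolution, fun w hw => hle.trans ?_⟩
  · refine ⟨fun i => ⟨(3 * I.rho + 4) * |I.x i - y i|, by positivity⟩, ?_, fun i => le_rfl⟩
    refine hle.trans_eq ?_
    rw [hyS, Finset.mul_sum, ← Finset.sum_coe_sort S]
    refine Finset.sum_congr rfl fun i _ => ?_
    rw [abs_sub_comm]
    rfl
  · exact mul_le_mul_of_nonneg_left (hy.2 w hw) (by linarith)
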